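/- Let $A$ be a quantum system with Hilbert space $\mathcal H_A=\mathbb C^d$, let $E$ be a one-qubit environment with Hilbert space $\mathbb C^2$ and Pauli matrices $X,Y$, and let $S_A\subset\mathbb B(\mathcal H_A)$ be a set of operators. Put $$S_{AE}=\{s\otimes 1: s\in S_A\}\ \cup\ \{s\otimes X: s\in S_A\}\ \cup\ \{1\otimes X,\,1\otimes Y\}\subset\mathbb B(\mathcal H_A\otimes\mathbb C^2).$$ Let $\mathrm{chan}_{AE}(S)$ be the smallest set of linear maps on $\mathbb B(\mathcal H_A\otimes\mathbb C^2)$ such that - (UN) if $H=H^*$ and $iH$ lies in the complex linear span of $S_{AE}$, then $\rho\mapsto e^{itH}\rho e^{-itH}$ belongs to it for every $t\in\mathbb R$; - (PR) it contains the preparation map $E_{prep}$, the linear map with $E_{prep}(\rho_A\otimes\rho_E)=\mathrm{tr}(\rho_E)\,\rho_A\otimes|0\rangle\langle 0|$; - (CO) it is closed under composition; - (CL) it is topologically closed; - (CC) it is convex. Let $\mathrm{chan}_A(S)$ be the set of all maps $\Phi(\rho)=\mathrm{tr}_E\big(\Psi(\rho\otimes|0\rangle\langle 0|)\big)$ on $\mathbb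 B(\mathcal H_A)$ with $\Psi\in\mathrm{chan}_{AE}(S)$. A set $T$ of anti-Hermitian operators on $\mathbb C^d$ is called a Hörmander system if the real linear span of the iterated commutators $[h_1,[h_2,\dots,[h_{m-1},h_m]]]$, with $m\ge 1$ and $h_j\in T$, is $\mathfrak{su}(d)$, the space of traceless anti-Hermitian operators. A Lindbladian on $A$ is a linear map $L$ on $\mathbb B(\mathcal H_A)$ such that $e^{tL}$ is completely positive and trace preserving for all $t\ge 0$. **Theorem.** If the complex linear span of $S_A$ contains a Hörmander system, then $e^{tL}\in\mathrm{chan}_A(S)$ for every Lindbladian $L$ on $A$ and every $t\ge 0$. -/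

import Mathlib

-- The operator norm on `Matrix n n ℂ = 𝔹(ℂⁿ)`. Its topology is the usual one.
open scoped Matrix.Norms.L2Operator
-- The order on `ℂ` needed for `Matrix.PosSemidef`.
open scoped ComplexOrder

namespace EnvAssisted

/-- Superoperators on `𝔹(ℂⁿ)`, with the topology of the operator norm. -/
abbrev SuperOp (n : Type*) [Fintype n] [DecidableEq n] : Type _ :=
  Matrix n n ℂ →L[ℂ] Matrix n n ℂ

section Channels

variable {n : Type*} [Fintype n] [DecidableEq n]

/-- The amplification `Φ ⊗ id_k`, acting on `𝔹(ℂⁿ ⊗ ℂᵏ)`: the map `Φ` is applied to each of the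
blocks `(M (i, a) (j, b))_{i,j}`. -/
noncomputable def amplify (Φ : SuperOp n) (k : ℕ) (M : Matrix (n × Fin k) (n × Fin k) ℂ) :
    Matrix (n × Fin k) (n × Fin k) ℂ :=
  Matrix.of fun p q => Φ (Matrix.of fun i j => M (i, p.2) (j, q.2)) p.1 q.1

/-- Complete positivity: every amplification `Φ ⊗ id_k` preserves positive semidefiniteness. -/
def IsCompletelyPositive (Φ : SuperOp n) : Prop :=
  ∀ (k : ℕ) (M : Matrix (n × Fin k) (n × Fin k) ℂ), M.PosSemidef → (amplify Φ k M).PosSemidef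

def IsTracePreserving (Φ : SuperOp n) : Prop :=
  ∀ ρ : Matrix n n ℂ, (Φ ρ).trace = ρ.trace

/-- Quantum channels: completely positive trace-preserving maps. -/
def IsChannel (Φ : SuperOp n) : Prop :=
  IsCompletelyPositive Φ ∧ IsTracePreserving Φ

/-- Lindbladians: the generators of one-parameter semigroups `(e^{tL})_{t ≥ 0}` of channels. -/
def IsLindbladian (L : SuperOp n) : Prop :=
  ∀ t : ℝ, 0 ≤ t → IsChannel (NormedSpace.exp ((t : ℂ) • L))

/-- Unitary evolution for time `t` with Hamiltonian `H`: the map `ρ ↦ e^{itH} ρ e^{-itH}`. -/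
noncomputable def unitaryEvolution (H : Matrix n n ℂ) (t : ℝ) : SuperOp n :=
  LinearMap.toContinuousLinearMap
    (LinearMap.mulLeftRight ℂ
      (NormedSpace.exp ((Complex.I * (t : ℂ)) • H), NormedSpace.exp (-(Complex.I * (t : ℂ)) • H)))

end Channels

section Hormander

variable {n : Type*} [Fintype n] [DecidableEq n]

/-- The iterated commutators `[h₁, [h₂, … [h_{m-1}, h_m]]]` with all `h_j ∈ T` and `m ≥ 1`. -/
inductive IsIteratedCommutator (T : Set (Matrix n n ℂ)) : Matrix n n ℂ → Prop
  | base {h : Matrix n n ℂ} (hh : h ∈ T) : IsIteratedCommutator T h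
  | step {h c : Matrix n n ℂ} (hh : h ∈ T) (hc : IsIteratedCommutator T c) :
      IsIteratedCommutator T (h * c - c * h)

/-- A set `T` of anti-Hermitian operators on `ℂᵈ` is a Hörmander system if the real linear span of
its iterated commutators is `𝔰𝔲(d)`, the space of traceless anti-Hermitian operators. -/
def IsHormanderSystem (T : Set (Matrix n n ℂ)) : Prop :=
  (∀ h ∈ T, h.conjTranspose = -h) ∧
    (Submodule.span ℝ {c | IsIteratedCommutator T c} : Set (Matrix n n ℂ)) =
      {A | A.conjTranspose = -A ∧ A.trace = 0}

end Hormander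

section Environment

variable {ι : Type*} [Fintype ι] [DecidableEq ι]

def pauliX : Matrix (Fin 2) (Fin 2) ℂ := !![0, 1; 1, 0]

def pauliY : Matrix (Fin 2) (Fin 2) ℂ := !![0, -Complex.I; Complex.I, 0]

/-- The state `|0⟩⟨0|` of the one-qubit environment. -/
def ket0bra0 : Matrix (Fin 2) (Fin 2) ℂ := !![1, 0; 0, 0]

/-- The resource set `S_A ⊗ 1 ∪ S_A ⊗ X ∪ 1 ⊗ {X, Y}` on `A ⊗ E`, where `E` is one qubit. -/
def resourceAE (S : Set (Matrix ι ι ℂ)) : Set (Matrix (ι × Fin 2) (ι × Fin 2) ℂ) :=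
  (fun s => Matrix.kronecker s (1 : Matrix (Fin 2) (Fin 2) ℂ)) '' S ∪
    (fun s => Matrix.kronecker s pauliX) '' S ∪
      (fun e => Matrix.kronecker (1 : Matrix ι ι ℂ) e) '' {pauliX, pauliY}

/-- The partial trace over the environment. -/
def traceE : Matrix (ι × Fin 2) (ι × Fin 2) ℂ →ₗ[ℂ] Matrix ι ι ℂ where
  toFun M := Matrix.of fun i j => ∑ a : Fin 2, M (i, a) (j, a)
  map_add' M N := by
    ext i j
    simp [Finset.sum_add_distrib]
  map_smul' c M := by
    ext i j
    simp [mul_add]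

/-- Initialization of the environment: `ρ ↦ ρ ⊗ |0⟩⟨0|`. -/
def tensor0 : Matrix ι ι ℂ →ₗ[ℂ] Matrix (ι × Fin 2) (ι × Fin 2) ℂ where
  toFun ρ := Matrix.kronecker ρ ket0bra0
  map_add' ρ σ := Matrix.add_kronecker ρ σ ket0bra0
  map_smul' c ρ := Matrix.smul_kronecker c ρ ket0bra0

/-- State preparation: the linear map with `ρ_A ⊗ ρ_E ↦ tr(ρ_E) ρ_A ⊗ |0⟩⟨0|`. -/
noncomputable def prep : SuperOp (ι × Fin 2) :=
  LinearMap.toContinuousLinearMap (tensor0 ∘ₗ traceE)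

/-- The closure properties of a class of evolutions of `A ⊗ E` generated by the resources `S`. -/
structure IsEvolutionClass (S : Set (Matrix ι ι ℂ)) (C : Set (SuperOp (ι × Fin 2))) : Prop where
  unitary_mem : ∀ H : Matrix (ι × Fin 2) (ι × Fin 2) ℂ, H.IsHermitian →
    Complex.I • H ∈ Submodule.span ℂ (resourceAE S) → ∀ t : ℝ, unitaryEvolution H t ∈ C
  prep_mem : prep ∈ C
  comp_mem : ∀ Φ ∈ C, ∀ Ψ ∈ C, Φ.comp Ψ ∈ C
  isClosed : IsClosed C
  convex : Convex ℝ C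

/-- The class generated by `S` on `A ⊗ E`: the smallest one with the above properties. -/
def chanAE (S : Set (Matrix ι ι ℂ)) : Set (SuperOp (ι × Fin 2)) :=
  ⋂₀ {C | IsEvolutionClass S C}

/-- The reduced class: all `ρ ↦ tr_E (Ψ (ρ ⊗ |0⟩⟨0|))` with `Ψ ∈ chanAE S`. -/
def chanA (S : Set (Matrix ι ι ℂ)) : Set (SuperOp ι) :=
  {Φ | ∃ Ψ ∈ chanAE S, ∀ ρ : Matrix ι ι ℂ, Φ ρ = traceE (Ψ (tensor0 ρ))}

end Environment

end EnvAssisted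

/-! The generators of one-parameter semigroups inside a closed convex monoid `C` form a closed
convex cone that contains `x - 1` for every `x ∈ C` (`exp_smul_sub_one_mem`, `add_mem_generators`).
Those whose negatives are also generators form a Lie algebra.

On `A ⊗ E` this Lie algebra contains the coupling `G = K ⊗ |1⟩⟨0| - K^* ⊗ |0⟩⟨1|` for every operator
`K` (`coupling_mem`). Initializing `E`, evolving for time `s` under `G` and tracing out `E` gives `1
+ s² D_K + o(s²)`, where `D_K` is the dissipator of `K`: the first-order term is off-diagonal in `E`
and is killed by the trace. So every `D_K` generates a semigroup in the reduced monoid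
(`compress_sq_mem_generators`).

The normal form of Lindbladians is not needed. A channel with Kraus operators `K_p` satisfies `Φ - 1
= ∑ D_{K_p}`, since `∑ K_p^* K_p = 1`; hence `e^{sL} - 1` is a generator for all `s ≥ 0`, and so is
`L = lim s⁻¹ (e^{sL} - 1)`. -/

namespace EnvAssisted

/-! ### Semigroup generators of closed convex monoids -/

section Generators

open Filter Topology NormedSpace

variable {𝔸 : Type*} [NormedRing 𝔸] [NormedAlgebra ℝ 𝔸]

/-- A closed convex submonoid of a real normed algebra. -/
structure IsClosedConvexMonoid (C : Set 𝔸) : Prop where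
  one_mem : 1 ∈ C
  mul_mem : ∀ x ∈ C, ∀ y ∈ C, x * y ∈ C
  isClosed : IsClosed C
  convex : Convex ℝ C

/-- The generators of the one-parameter semigroups `(e^{tX})_{t ≥ 0}` contained in `C`. -/
def generators (C : Set 𝔸) : Set 𝔸 :=
  {X | ∀ t : ℝ, 0 ≤ t → exp (t • X) ∈ C}

/-- Needed where the linear term compresses to zero and the quadratic one dominates. The error is
`s⁻²` times a Taylor remainder of order `s³`. -/
theorem tendsto_exp_second_order [CompleteSpace 𝔸] (X : 𝔸) :
    Tendsto (fun s : ℝ => (s ^ 2)⁻¹ • (exp (s • X) - 1 - s • X)) (𝓝[>] 0)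
      (𝓝 ((2⁻¹ : ℝ) • (X * X))) := by
  have h := (exp_hasFPowerSeriesAt_zero (𝕂 := ℝ) (𝔸 := 𝔸)).isBigO_sub_partialSum_pow 3
  obtain ⟨K, hK⟩ := h.bound
  have hs : Tendsto (fun s : ℝ => s • X) (𝓝[>] 0) (𝓝 0) := by
    have : Tendsto (fun s : ℝ => s • X) (𝓝 0) (𝓝 ((0 : ℝ) • X)) :=
      (continuous_id.smul continuous_const).tendsto 0
    rw [zero_smul] at this
    exact this.mono_left nhdsWithin_le_nhds
  have hlim : Tendsto (fun s : ℝ => s * (K * ‖X‖ ^ 3)) (𝓝[>] 0) (𝓝 0) := by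
    have : Tendsto (fun s : ℝ => s * (K * ‖X‖ ^ 3)) (𝓝 0) (𝓝 (0 * (K * ‖X‖ ^ 3))) :=
      (continuous_id.mul continuous_const).tendsto 0
    rw [zero_mul] at this
    exact this.mono_left nhdsWithin_le_nhds
  rw [tendsto_iff_norm_sub_tendsto_zero]
  refine squeeze_zero' (Eventually.of_forall fun _ => norm_nonneg _) ?_ hlim
  filter_upwards [hs.eventually hK, self_mem_nhdsWithin] with s h1 hs0
  have hs0 : 0 < s := hs0
  have e : (s ^ 2)⁻¹ • (exp (s • X) - 1 - s • X) - (2⁻¹ : ℝ) • (X * X) =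
      (s ^ 2)⁻¹ • (exp (0 + s • X) - (expSeries ℝ 𝔸).partialSum 3 (s • X)) := by
    have e2 : (2⁻¹ : ℝ) • (X * X) = (s ^ 2)⁻¹ • ((2⁻¹ : ℝ) • (s • X) ^ 2) := by
      rw [smul_pow, smul_smul, smul_smul, pow_two X]
      congr 1
      field_simp
    rw [e2, ← smul_sub]
    congr 1
    simp [FormalMultilinearSeries.partialSum, Finset.sum_range_succ, expSeries_apply_eq, sub_sub]
  rw [e, norm_smul, norm_inv, Real.norm_eq_abs, abs_of_pos (by positivity)]
  rw [Real.norm_of_nonneg (by positivity), norm_smul, Real.norm_of_nonneg hs0.le] at h1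
  calc _ ≤ (s ^ 2)⁻¹ * (K * (s * ‖X‖) ^ 3) := by gcongr
    _ = _ := by field_simp

namespace IsClosedConvexMonoid

variable {C : Set 𝔸}

theorem pow_mem (hC : IsClosedConvexMonoid C) {x : 𝔸} (hx : x ∈ C) (n : ℕ) : x ^ n ∈ C := by
  induction n with
  | zero => simpa using hC.one_mem
  | succ n ih => rw [pow_succ]; exact hC.mul_mem _ ih _ hx

theorem smul_mem_generators {c : ℝ} (hc : 0 ≤ c) {X : 𝔸}
    (hX : X ∈ generators C) : c • X ∈ generators C := fun t ht => by
  rw [smul_smul]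
  exact hX _ (mul_nonneg ht hc)

variable [CompleteSpace 𝔸]

/-- Poisson mixture: `e^{t(x-1)} = e^{-t} ∑ tⁿ/n! xⁿ` is a limit of convex combinations of powers of
`x`, namely the normalized partial sums. -/
theorem exp_smul_sub_one_mem (hC : IsClosedConvexMonoid C) {x : 𝔸} (hx : x ∈ C) {t : ℝ}
    (ht : 0 ≤ t) : exp (t • (x - 1)) ∈ C := by
  let _ : NormedAlgebra ℚ 𝔸 := NormedAlgebra.restrictScalars ℚ ℝ 𝔸
  have e : exp (t • (x - 1)) = (Real.exp t)⁻¹ • exp (t • x) := by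
    have h1 : t • (x - 1) = t • x + algebraMap ℝ 𝔸 (-t) := by
      rw [Algebra.algebraMap_eq_smul_one, smul_sub, neg_smul, sub_eq_add_neg]
    rw [h1, exp_add_of_commute (Algebra.commutes _ _).symm, ← algebraMap_exp_comm,
      ← Algebra.commutes, ← Algebra.smul_def, ← Real.exp_eq_exp_ℝ, Real.exp_neg]
  have h2 : HasSum (fun n : ℕ => (n.factorial⁻¹ : ℝ) • (t • x) ^ n) (exp (t • x)) :=
    exp_series_hasSum_exp' (t • x)
  have h3 : HasSum (fun n : ℕ => (n.factorial⁻¹ : ℝ) • t ^ n) (Real.exp t) := by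
    rw [Real.exp_eq_exp_ℝ]
    exact exp_series_hasSum_exp' t
  have h4 := ((h3.tendsto_sum_nat.inv₀ (Real.exp_ne_zero t)).smul h2.tendsto_sum_nat)
  rw [e]
  refine hC.isClosed.mem_of_tendsto h4 ?_
  filter_upwards [eventually_gt_atTop 0] with n hn
  have hpos : 0 < ∑ i ∈ Finset.range n, (i.factorial⁻¹ : ℝ) • t ^ i := by
    refine Finset.sum_pos' (fun i _ => by simp only [smul_eq_mul]; positivity)
      ⟨0, Finset.mem_range.2 hn, by simp⟩
  have := hC.convex.centerMass_mem (t := Finset.range n)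
    (w := fun i => (i.factorial⁻¹ : ℝ) • t ^ i) (z := fun i => x ^ i)
    (fun i _ => by simp only [smul_eq_mul]; positivity) hpos (fun i _ => hC.pow_mem hx i)
  rw [Finset.centerMass] at this
  convert this using 3 with i
  rw [smul_pow, smul_smul, smul_eq_mul]

theorem sub_one_mem_generators (hC : IsClosedConvexMonoid C) {x : 𝔸} (hx : x ∈ C) :
    x - 1 ∈ generators C := fun _ ht => hC.exp_smul_sub_one_mem hx ht

theorem isClosed_generators (hC : IsClosedConvexMonoid C) : IsClosed (generators C) := by
  let _ : NormedAlgebra ℚ 𝔸 := NormedAlgebra.restrictScalars ℚ ℝ 𝔸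
  simp only [generators, Set.ofPred_forall]
  refine isClosed_iInter fun t => isClosed_iInter fun _ => hC.isClosed.preimage ?_
  exact exp_continuous.comp (continuous_const_smul t)

theorem tendsto_slope_exp (X : 𝔸) :
    Tendsto (fun s : ℝ => s⁻¹ • (exp (s • X) - 1)) (𝓝[>] 0) (𝓝 X) := by
  have h := (hasDerivAt_exp_smul_const (𝕂 := ℝ) X (0 : ℝ)).tendsto_slope_zero_right
  simpa using h

/-- A sum of two generators is the limit of `2s⁻¹ (½ (e^{sX} + e^{sY}) - 1)` as `s → 0`. -/
theorem add_mem_generators (hC : IsClosedConvexMonoid C) {X Y : 𝔸}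
    (hX : X ∈ generators C) (hY : Y ∈ generators C) : X + Y ∈ generators C := by
  refine hC.isClosed_generators.mem_of_tendsto ((tendsto_slope_exp X).add (tendsto_slope_exp Y)) ?_
  filter_upwards [self_mem_nhdsWithin] with s hs
  have hs : 0 < s := hs
  have h := hC.convex (hX s hs.le) (hY s hs.le) (a := 2⁻¹) (b := 2⁻¹) (by norm_num) (by norm_num)
    (by norm_num)
  have h2 := smul_mem_generators (c := 2 * s⁻¹) (by positivity) (hC.sub_one_mem_generators h)
  convert h2 using 1
  simp only [smul_sub, smul_add, smul_smul]
  rw [show (2 * s⁻¹ * 2⁻¹ : ℝ) = s⁻¹ by ring, mul_comm, mul_two s⁻¹, add_smul]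
  abel

theorem zero_mem_generators (hC : IsClosedConvexMonoid C) : (0 : 𝔸) ∈ generators C := by
  simpa using hC.sub_one_mem_generators hC.one_mem

/-- The generators of the one-parameter groups contained in `C`. -/
def groupGenerators (hC : IsClosedConvexMonoid C) : Submodule ℝ 𝔸 where
  carrier := {X | X ∈ generators C ∧ -X ∈ generators C}
  zero_mem' := by simpa using hC.zero_mem_generators
  add_mem' := fun hX hY => ⟨hC.add_mem_generators hX.1 hY.1, by
    rw [neg_add]
    exact hC.add_mem_generators hX.2 hY.2⟩
  smul_mem' := fun c X hX => by
    obtain h | h := le_total 0 c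
    · exact ⟨smul_mem_generators h hX.1, by
        rw [← smul_neg]
        exact smul_mem_generators h hX.2⟩
    · refine ⟨?_, ?_⟩
      · rw [← neg_smul_neg]
        exact smul_mem_generators (neg_nonneg.2 h) hX.2
      · rw [← neg_smul]
        exact smul_mem_generators (neg_nonneg.2 h) hX.1

theorem mem_groupGenerators (hC : IsClosedConvexMonoid C) {X : 𝔸} :
    X ∈ hC.groupGenerators ↔ ∀ t : ℝ, exp (t • X) ∈ C := by
  constructor
  · intro h t
    obtain ht | ht := le_total 0 t
    · exact h.1 t ht
    · rw [← neg_smul_neg]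
      exact h.2 (-t) (neg_nonneg.2 ht)
  · exact fun h => ⟨fun t _ => h t, fun t _ => by
      rw [smul_neg, ← neg_smul]
      exact h _⟩

theorem conj_mem_generators (hC : IsClosedConvexMonoid C) {A B : 𝔸}
    (hA : A ∈ hC.groupGenerators) (hB : B ∈ generators C) (s : ℝ) :
    exp (s • A) * B * exp (-(s • A)) ∈ generators C := by
  let _ : NormedAlgebra ℚ 𝔸 := NormedAlgebra.restrictScalars ℚ ℝ 𝔸
  intro t ht
  have h1 : exp (s • A) * exp (-(s • A)) = 1 := by
    rw [← exp_add_of_commute (Commute.neg_right rfl), add_neg_cancel, exp_zero]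
  have h2 : exp (-(s • A)) * exp (s • A) = 1 := by
    rw [← exp_add_of_commute (Commute.neg_left rfl), neg_add_cancel, exp_zero]
  let u : 𝔸ˣ := ⟨exp (s • A), exp (-(s • A)), h1, h2⟩
  have e : exp (t • (exp (s • A) * B * exp (-(s • A)))) =
      exp (s • A) * exp (t • B) * exp (-(s • A)) := by
    have := exp_units_conj u (t • B)
    simpa [u] using this
  rw [e]
  rw [mem_groupGenerators] at hA
  refine hC.mul_mem _ (hC.mul_mem _ (hA s) _ (hB t ht)) _ ?_
  rw [← neg_smul]
  exact hA _

/-- `[A, B]` is the derivative at `0` of `e^{sA} B e^{-sA}`. The difference quotient is a positive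
multiple of a sum of two generators because `-B` is one as well. -/
theorem commutator_mem_generators (hC : IsClosedConvexMonoid C) {A B : 𝔸}
    (hA : A ∈ hC.groupGenerators) (hB : B ∈ hC.groupGenerators) :
    A * B - B * A ∈ generators C := by
  have h1 := hasDerivAt_exp_smul_const (𝕂 := ℝ) A (0 : ℝ)
  have h2 := hasDerivAt_exp_smul_const (𝕂 := ℝ) (-A) (0 : ℝ)
  have h := ((h1.mul_const B).mul h2).tendsto_slope_zero_right
  simp only [zero_smul, exp_zero, one_mul, mul_one, zero_add, mul_neg] at h
  rw [← sub_eq_add_neg] at h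
  refine hC.isClosed_generators.mem_of_tendsto h ?_
  filter_upwards [self_mem_nhdsWithin] with s hs
  have hs : 0 < s := hs
  refine smul_mem_generators (by positivity) ?_
  rw [sub_eq_add_neg]
  refine hC.add_mem_generators ?_ (by simpa using hB.2)
  simpa using hC.conj_mem_generators hA hB.1 s

theorem commutator_mem_groupGenerators (hC : IsClosedConvexMonoid C) {A B : 𝔸}
    (hA : A ∈ hC.groupGenerators) (hB : B ∈ hC.groupGenerators) :
    A * B - B * A ∈ hC.groupGenerators :=
  ⟨hC.commutator_mem_generators hA hB, by
    rw [neg_sub]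
    exact hC.commutator_mem_generators hB hA⟩

theorem mem_generators_of_exp_sub_one_mem (hC : IsClosedConvexMonoid C) {X : 𝔸}
    (h : ∀ s : ℝ, 0 ≤ s → exp (s • X) - 1 ∈ generators C) : X ∈ generators C := by
  refine hC.isClosed_generators.mem_of_tendsto (tendsto_slope_exp X) ?_
  filter_upwards [self_mem_nhdsWithin] with s hs
  have hs : 0 < s := hs
  exact smul_mem_generators (by positivity) (h s hs.le)

end IsClosedConvexMonoid

end Generators

/-! ### Inner derivations and conjugations -/

section Derivation

open NormedSpace

variable {R : Type*} [NormedRing R] [NormedAlgebra ℂ R]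

/-- The inner derivation `M ↦ [G, M]` as a bounded operator. -/
noncomputable def ad : R →ₗ[ℝ] (R →L[ℂ] R) where
  toFun G := ContinuousLinearMap.mul ℂ R G - (ContinuousLinearMap.mul ℂ R).flip G
  map_add' G G' := by
    simp only [map_add]
    abel
  map_smul' c G := by
    ext M
    simp [smul_sub]

theorem ad_apply (G M : R) : ad G M = G * M - M * G := rfl

theorem ad_commutator (A B : R) : ad (A * B - B * A) = ad A * ad B - ad B * ad A := by
  ext M
  change _ = ad A (ad B M) - ad B (ad A M)
  simp only [ad_apply]
  noncomm_ring

/-- Left multiplication as a ring homomorphism into the bounded operators. -/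
noncomputable def leftMul : R →+* (R →L[ℂ] R) where
  toFun G := ContinuousLinearMap.mul ℂ R G
  map_one' := by ext M; simp
  map_mul' G G' := by ext M; simp [mul_assoc]
  map_zero' := by ext M; simp
  map_add' G G' := by ext M; simp

/-- Right multiplication as a ring homomorphism from the opposite ring into the bounded
operators. -/
noncomputable def rightMul : Rᵐᵒᵖ →+* (R →L[ℂ] R) where
  toFun G := (ContinuousLinearMap.mul ℂ R).flip G.unop
  map_one' := by ext M; simp
  map_mul' G G' := by ext M; simp [mul_assoc]
  map_zero' := by ext M; simp
  map_add' G G' := by ext M; simp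

theorem leftMul_apply (G M : R) : leftMul G M = G * M := rfl

theorem rightMul_apply (G M : R) : rightMul (MulOpposite.op G) M = M * G := rfl

theorem continuous_leftMul : Continuous (leftMul (R := R)) :=
  (ContinuousLinearMap.mul ℂ R).continuous

theorem continuous_rightMul : Continuous (rightMul (R := R)) :=
  (ContinuousLinearMap.mul ℂ R).flip.continuous.comp MulOpposite.continuous_unop

/-- Left and right multiplications commute, so the exponential of their sum factors. -/
theorem exp_ad_apply [CompleteSpace R] (G M : R) :
    exp (ad G) M = exp G * M * exp (-G) := by
  let _ : NormedAlgebra ℚ (R →L[ℂ] R) := NormedAlgebra.restrictScalars ℚ ℝ (R →L[ℂ] R)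
  let _ : NormedAlgebra ℚ R := NormedAlgebra.restrictScalars ℚ ℝ R
  have e : ad G = leftMul G + rightMul (MulOpposite.op (-G)) := by
    ext M
    simp [ad_apply, leftMul_apply, rightMul_apply, sub_eq_add_neg]
  have hcomm : Commute (leftMul G) (rightMul (MulOpposite.op (-G))) := by
    ext M
    simp [leftMul_apply, rightMul_apply, mul_assoc]
  rw [e, exp_add_of_commute hcomm, ← map_exp (leftMul (R := R)) continuous_leftMul,
    ← map_exp (rightMul (R := R)) continuous_rightMul, exp_op]
  simp [leftMul_apply, rightMul_apply, mul_assoc]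

namespace IsClosedConvexMonoid

variable {C : Set (R →L[ℂ] R)} [CompleteSpace R]

/-- The elements `G` for which all conjugations `M ↦ e^{tG} M e^{-tG}` lie in `C`. -/
noncomputable def conjGenerators (hC : IsClosedConvexMonoid C) : Submodule ℝ R :=
  hC.groupGenerators.comap ad

theorem commutator_mem_conjGenerators (hC : IsClosedConvexMonoid C) {A B : R}
    (hA : A ∈ hC.conjGenerators) (hB : B ∈ hC.conjGenerators) :
    A * B - B * A ∈ hC.conjGenerators := by
  rw [conjGenerators, Submodule.mem_comap, ad_commutator]
  exact hC.commutator_mem_groupGenerators hA hB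

theorem mem_conjGenerators (hC : IsClosedConvexMonoid C) {G : R} :
    G ∈ hC.conjGenerators ↔ ∀ t : ℝ, exp (ad (t • G)) ∈ C := by
  simp only [conjGenerators, Submodule.mem_comap, mem_groupGenerators, map_smul]

end IsClosedConvexMonoid

end Derivation

/-! ### Compression of a monoid along a retract -/

section Compression

open NormedSpace Filter Topology

variable {E F : Type*} [NormedAddCommGroup E] [NormedSpace ℂ E] [NormedAddCommGroup F]
  [NormedSpace ℂ F]

/-- The operators on `E` whose extension along the retract `i : E → F`, `p : F → E` lies in `C`. -/
def compression (C : Set (F →L[ℂ] F)) (i : E →L[ℂ] F) (p : F →L[ℂ] E) : Set (E →L[ℂ] E) :=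
  {Φ | i.comp (Φ.comp p) ∈ C}

variable {C : Set (F →L[ℂ] F)} {i : E →L[ℂ] F} {p : F →L[ℂ] E}

/-- As `p ∘ i = 1`, the map `Φ ↦ i Φ p` is multiplicative and sends `1` to the idempotent `i p`,
which plays the role of state preparation. -/
theorem IsClosedConvexMonoid.compression (hC : IsClosedConvexMonoid C)
    (hpi : p.comp i = ContinuousLinearMap.id ℂ E) (hip : i.comp p ∈ C) :
    IsClosedConvexMonoid (compression C i p) where
  one_mem := hip
  mul_mem Φ hΦ Ψ hΨ := by
    have h := hC.mul_mem _ hΦ _ hΨ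
    have e : i.comp (Φ.comp p) * i.comp (Ψ.comp p) = i.comp ((Φ * Ψ).comp p) := by
      ext x
      have := DFunLike.congr_fun hpi (Ψ (p x))
      simp only [ContinuousLinearMap.comp_apply, ContinuousLinearMap.id_apply] at this
      simp [this]
    rwa [e] at h
  isClosed := hC.isClosed.preimage (by fun_prop)
  convex Φ hΦ Ψ hΨ a b ha hb hab := by
    have h := hC.convex hΦ hΨ ha hb hab
    have e : a • i.comp (Φ.comp p) + b • i.comp (Ψ.comp p) = i.comp ((a • Φ + b • Ψ).comp p) := by
      ext x
      simp only [ContinuousLinearMap.comp_apply, add_apply, smul_apply, map_add]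
      rw [← Complex.coe_smul a (Φ _), ← Complex.coe_smul b (Ψ _), map_smul, map_smul]
      simp
    rwa [e] at h

theorem compress_mem_compression (hC : IsClosedConvexMonoid C) (hip : i.comp p ∈ C)
    {Ψ : F →L[ℂ] F} (hΨ : Ψ ∈ C) : p.comp (Ψ.comp i) ∈ EnvAssisted.compression C i p :=
  hC.mul_mem _ hip _ (hC.mul_mem _ hΨ _ hip)

/-- If the compression of the generator `X` of a group vanishes, then `e^{sX}` compresses to
`1 + s²/2 p X² i + o(s²)`. -/
theorem compress_sq_mem_generators [CompleteSpace E] [CompleteSpace F]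
    (hC : IsClosedConvexMonoid C) (hpi : p.comp i = ContinuousLinearMap.id ℂ E)
    (hip : i.comp p ∈ C) {X : F →L[ℂ] F} (hX : X ∈ hC.groupGenerators)
    (h0 : p.comp (X.comp i) = 0) :
    p.comp ((X * X).comp i) ∈ generators (EnvAssisted.compression C i p) := by
  have hD := hC.compression hpi hip
  have hcont : Continuous fun Y : F →L[ℂ] F => p.comp (Y.comp i) := by fun_prop
  have hsmul : ∀ (c : ℝ) (Y : F →L[ℂ] F), p.comp ((c • Y).comp i) = c • p.comp (Y.comp i) := by
    intro c Y
    ext x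
    simp only [ContinuousLinearMap.comp_apply, smul_apply]
    rw [← Complex.coe_smul c (Y _), map_smul]
    simp
  have h := (hcont.tendsto _).comp (tendsto_exp_second_order X)
  have h2 : p.comp (((2⁻¹ : ℝ) • (X * X)).comp i) ∈
      generators (EnvAssisted.compression C i p) := by
    refine hD.isClosed_generators.mem_of_tendsto h ?_
    filter_upwards [self_mem_nhdsWithin] with s hs
    have hs : 0 < s := hs
    simp only [Function.comp_apply, hsmul]
    refine IsClosedConvexMonoid.smul_mem_generators (by positivity) ?_
    -- With no linear term left, the quotient is a positive multiple of an element of the compressed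
    -- monoid minus `1`.
    have e : p.comp ((exp (s • X) - 1 - s • X).comp i) = p.comp ((exp (s • X)).comp i) - 1 := by
      rw [ContinuousLinearMap.sub_comp, ContinuousLinearMap.sub_comp, ContinuousLinearMap.comp_sub,
        ContinuousLinearMap.comp_sub, hsmul, h0, smul_zero, sub_zero]
      congr 1
    rw [e]
    exact hD.sub_one_mem_generators
      (compress_mem_compression hC hip (hC.mem_groupGenerators.1 hX s))
  have h3 := IsClosedConvexMonoid.smul_mem_generators (c := 2) (by norm_num) h2
  rw [hsmul, smul_smul] at h3
  simpa using h3

end Compression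

/-! ### Unitary evolutions as exponentials of derivations -/

section UnitaryEvolution

open NormedSpace

variable {n : Type*} [Fintype n] [DecidableEq n]

theorem unitaryEvolution_eq_exp (H : Matrix n n ℂ) (t : ℝ) :
    unitaryEvolution H t = exp (ad (t • Complex.I • H)) := by
  ext1 M
  have e : (Complex.I * (t : ℂ)) • H = t • Complex.I • H := by
    rw [mul_comm, mul_smul]
    simp
  refine Eq.trans ?_ (exp_ad_apply (t • Complex.I • H) M).symm
  rw [← e]
  simp [unitaryEvolution, neg_smul]

end UnitaryEvolution

/-! ### The Lie algebra of unitary controls on `A ⊗ E` -/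

section Environment

open Matrix

theorem kronecker_commutator_left {ι k : Type*} [Fintype ι] [Fintype k] (A B : Matrix ι ι ℂ)
    (P Q : Matrix k k ℂ) (h : P * Q = Q * P) :
    kronecker A P * kronecker B Q - kronecker B Q * kronecker A P =
      kronecker (A * B - B * A) (P * Q) := by
  simp only [kronecker]
  rw [← mul_kronecker_mul, ← mul_kronecker_mul, h]
  ext
  simp [sub_mul]

theorem kronecker_commutator_right {ι k : Type*} [Fintype ι] [DecidableEq ι] [Fintype k]
    (A : Matrix ι ι ℂ)
    (P Q : Matrix k k ℂ) :
    kronecker A P * kronecker (1 : Matrix ι ι ℂ) Q -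
      kronecker (1 : Matrix ι ι ℂ) Q * kronecker A P = kronecker A (P * Q - Q * P) := by
  simp only [kronecker]
  rw [← mul_kronecker_mul, ← mul_kronecker_mul, mul_one, one_mul]
  ext
  simp [mul_sub]

theorem kronecker_mem_span_resourceAE {ι : Type*} [DecidableEq ι] {S : Set (Matrix ι ι ℂ)}
    {h : Matrix ι ι ℂ}
    (hh : h ∈ Submodule.span ℂ S) :
    kronecker h (1 : Matrix (Fin 2) (Fin 2) ℂ) ∈ Submodule.span ℂ (resourceAE S) ∧
      kronecker h pauliX ∈ Submodule.span ℂ (resourceAE S) := by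
  induction hh using Submodule.span_induction with
  | mem x hx =>
    exact ⟨Submodule.subset_span (Or.inl (Or.inl ⟨x, hx, rfl⟩)),
      Submodule.subset_span (Or.inl (Or.inr ⟨x, hx, rfl⟩))⟩
  | zero => simp [kronecker]
  | add x y _ _ hx hy =>
    simp only [kronecker, add_kronecker]
    exact ⟨add_mem hx.1 hy.1, add_mem hx.2 hy.2⟩
  | smul c x _ hx =>
    simp only [kronecker, smul_kronecker]
    exact ⟨Submodule.smul_mem _ c hx.1, Submodule.smul_mem _ c hx.2⟩

theorem pauliX_conjTranspose : pauliXᴴ = pauliX := by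
  ext i j; fin_cases i <;> fin_cases j <;> simp [pauliX]

theorem pauliY_conjTranspose : pauliYᴴ = pauliY := by
  ext i j; fin_cases i <;> fin_cases j <;> simp [pauliY]

theorem pauliX_double_commutator :
    pauliX * (pauliX * pauliY - pauliY * pauliX) - (pauliX * pauliY - pauliY * pauliX) * pauliX =
      (4 : ℝ) • pauliY := by
  ext i j
  fin_cases i <;> fin_cases j <;> simp [pauliX, pauliY] <;> ring

namespace IsEvolutionClass

variable {ι : Type*} [Fintype ι] [DecidableEq ι] {S : Set (Matrix ι ι ℂ)}
  {C : Set (SuperOp (ι × Fin 2))}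

theorem isClosedConvexMonoid (hC : IsEvolutionClass S C) : IsClosedConvexMonoid C where
  one_mem := by
    -- The identity is the evolution with zero Hamiltonian.
    have h := hC.unitary_mem 0 isHermitian_zero (by simp) 0
    have e : unitaryEvolution (0 : Matrix (ι × Fin 2) (ι × Fin 2) ℂ) 0 = 1 := by
      ext1 M
      simp [unitaryEvolution]
    rwa [e] at h
  mul_mem := hC.comp_mem
  isClosed := hC.isClosed
  convex := hC.convex

/-- The operators `G` generating unitary evolutions `e^{tG} · e^{-tG}` in the class `C`. -/
noncomputable def unitaryGenerators (hC : IsEvolutionClass S C) :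
    Submodule ℝ (Matrix (ι × Fin 2) (ι × Fin 2) ℂ) :=
  hC.isClosedConvexMonoid.conjGenerators

theorem commutator_mem (hC : IsEvolutionClass S C) {A B : Matrix (ι × Fin 2) (ι × Fin 2) ℂ}
    (hA : A ∈ hC.unitaryGenerators) (hB : B ∈ hC.unitaryGenerators) :
    A * B - B * A ∈ hC.unitaryGenerators :=
  hC.isClosedConvexMonoid.commutator_mem_conjGenerators hA hB

theorem mem_unitaryGenerators_of_mem_span (hC : IsEvolutionClass S C)
    {A : Matrix (ι × Fin 2) (ι × Fin 2) ℂ} (hA : Aᴴ = -A)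
    (hs : A ∈ Submodule.span ℂ (resourceAE S)) : A ∈ hC.unitaryGenerators := by
  refine hC.isClosedConvexMonoid.mem_conjGenerators.2 fun t => ?_
  have e : Complex.I • (-Complex.I • A) = A := by
    rw [smul_smul]
    simp
  have hH : (-Complex.I • A).IsHermitian := by
    rw [IsHermitian, conjTranspose_smul, hA]
    simp
  have h := hC.unitary_mem (-Complex.I • A) hH (by rwa [e]) t
  rwa [unitaryEvolution_eq_exp, e] at h

theorem one_kronecker_mem (hC : IsEvolutionClass S C) {P : Matrix (Fin 2) (Fin 2) ℂ}
    (hP : P = pauliX ∨ P = pauliY) :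
    kronecker (1 : Matrix ι ι ℂ) (Complex.I • P) ∈ hC.unitaryGenerators := by
  have hPs : Pᴴ = P := by
    rcases hP with rfl | rfl
    exacts [pauliX_conjTranspose, pauliY_conjTranspose]
  refine hC.mem_unitaryGenerators_of_mem_span ?_ ?_
  · rw [kronecker, conjTranspose_kronecker, conjTranspose_smul, hPs, conjTranspose_one]
    ext
    simp
  · have e : kronecker (1 : Matrix ι ι ℂ) (Complex.I • P) =
        Complex.I • kronecker (1 : Matrix ι ι ℂ) P := kronecker_smul _ _ _
    rw [e]
    refine Submodule.smul_mem _ _ (Submodule.subset_span (Or.inr ⟨P, hP, rfl⟩))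

/-- `[h ⊗ 1, c ⊗ X] = [h, c] ⊗ X`, so only the innermost element of an iterated commutator has to
carry the factor `X`. -/
theorem traceless_kronecker_pauliX_mem (hC : IsEvolutionClass S C) {T : Set (Matrix ι ι ℂ)}
    (hT : IsHormanderSystem T) (hTS : T ⊆ (Submodule.span ℂ S : Set (Matrix ι ι ℂ)))
    {A : Matrix ι ι ℂ} (hA : Aᴴ = -A) (htr : A.trace = 0) :
    kronecker A pauliX ∈ hC.unitaryGenerators := by
  have hbase : ∀ h ∈ T, kronecker h (1 : Matrix (Fin 2) (Fin 2) ℂ) ∈ hC.unitaryGenerators ∧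
      kronecker h pauliX ∈ hC.unitaryGenerators := by
    intro h hh
    have hs := kronecker_mem_span_resourceAE (hTS hh)
    refine ⟨hC.mem_unitaryGenerators_of_mem_span ?_ hs.1,
      hC.mem_unitaryGenerators_of_mem_span ?_ hs.2⟩
    · rw [kronecker, conjTranspose_kronecker, hT.1 h hh, conjTranspose_one]
      ext
      simp
    · rw [kronecker, conjTranspose_kronecker, hT.1 h hh, pauliX_conjTranspose]
      ext
      simp
  have hcomm : ∀ c, IsIteratedCommutator T c → kronecker c pauliX ∈ hC.unitaryGenerators := by
    intro c hc
    induction hc with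
    | base hh => exact (hbase _ hh).2
    | step hh _ ih =>
      have := hC.commutator_mem (hbase _ hh).1 ih
      rwa [kronecker_commutator_left _ _ _ _ (by simp), one_mul] at this
  replace hA : A ∈ Submodule.span ℝ {c | IsIteratedCommutator T c} := by
    rw [← SetLike.mem_coe, hT.2]
    exact ⟨hA, htr⟩
  clear * - hA hcomm
  induction hA using Submodule.span_induction with
  | mem x hx => exact hcomm x hx
  | zero => simp [kronecker]
  | add x y _ _ hx hy =>
    simp only [kronecker, add_kronecker]
    exact add_mem hx hy
  | smul c x _ hx =>
    simp only [kronecker, smul_kronecker]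
    exact Submodule.smul_mem _ c hx

theorem kronecker_pauliX_mem (hC : IsEvolutionClass S C) {T : Set (Matrix ι ι ℂ)}
    (hT : IsHormanderSystem T) (hTS : T ⊆ (Submodule.span ℂ S : Set (Matrix ι ι ℂ)))
    {A : Matrix ι ι ℂ} (hA : Aᴴ = -A) : kronecker A pauliX ∈ hC.unitaryGenerators := by
  -- `i r 1` is the trace part of `A`; it is restored by the control `1 ⊗ iX`.
  set r : ℝ := A.trace.im / Fintype.card ι with hr
  have htr : A.trace = A.trace.im * Complex.I := by
    have h : star A.trace = -A.trace := by rw [← trace_conjTranspose, hA, trace_neg]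
    apply Complex.ext
    · have := congrArg Complex.re h
      simp at this ⊢
      linarith
    · simp
  have h1 := hC.traceless_kronecker_pauliX_mem hT hTS (A := A - r • (Complex.I • 1))
    (by
      rw [conjTranspose_sub, hA]
      ext i j
      by_cases hij : i = j <;> simp [hij, one_apply, eq_comm]
      ring)
    (by
      rw [trace_sub, htr, trace_smul, trace_smul, trace_one]
      obtain h | h := isEmpty_or_nonempty ι
      · simp [trace]
      · have : (Fintype.card ι : ℂ) ≠ 0 := by simp
        simp [hr]
        field_simp
        simp)
  have h2 := hC.unitaryGenerators.smul_mem r (hC.one_kronecker_mem (Or.inl rfl))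
  have h3 := add_mem h1 h2
  convert h3 using 1
  ext
  simp [sub_mul]
  ring

/-- `Y` is recovered from `[X, [X, Y]] = 4Y`, with `[X, Y]` obtained from the controls of `E` alone.
-/
theorem kronecker_pauliY_mem (hC : IsEvolutionClass S C) {T : Set (Matrix ι ι ℂ)}
    (hT : IsHormanderSystem T) (hTS : T ⊆ (Submodule.span ℂ S : Set (Matrix ι ι ℂ)))
    {A : Matrix ι ι ℂ} (hA : Aᴴ = -A) : kronecker A pauliY ∈ hC.unitaryGenerators := by
  have h1 := hC.commutator_mem (hC.one_kronecker_mem (Or.inl rfl))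
    (hC.one_kronecker_mem (Or.inr rfl))
  rw [kronecker_commutator_right] at h1
  have h2 := hC.commutator_mem (hC.kronecker_pauliX_mem hT hTS hA) h1
  rw [kronecker_commutator_right] at h2
  have h3 := hC.unitaryGenerators.smul_mem (-4⁻¹ : ℝ) h2
  convert h3 using 1
  have e : (Complex.I • pauliX) * (Complex.I • pauliY) - (Complex.I • pauliY) * (Complex.I • pauliX)
      = -(pauliX * pauliY - pauliY * pauliX) := by
    simp [smul_smul]
    abel
  rw [e, mul_neg, neg_mul, ← neg_sub', pauliX_double_commutator]
  ext
  simp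
  ring

/-- As `|1⟩⟨0| = (X - iY)/2`, the coupling equals `½(K - K^*) ⊗ X - (i/2)(K + K^*) ⊗ Y`, and both
system factors are anti-Hermitian. -/
theorem coupling_mem (hC : IsEvolutionClass S C) {T : Set (Matrix ι ι ℂ)}
    (hT : IsHormanderSystem T) (hTS : T ⊆ (Submodule.span ℂ S : Set (Matrix ι ι ℂ)))
    (K : Matrix ι ι ℂ) :
    kronecker K !![0, 0; 1, 0] - kronecker Kᴴ !![0, 1; 0, 0] ∈ hC.unitaryGenerators := by
  have h1 := hC.kronecker_pauliX_mem hT hTS (A := (2⁻¹ : ℂ) • (K - Kᴴ)) (by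
    rw [conjTranspose_smul, conjTranspose_sub, conjTranspose_conjTranspose, ← smul_neg, neg_sub]
    simp)
  have h2 := hC.kronecker_pauliY_mem hT hTS (A := (-(2⁻¹ * Complex.I) : ℂ) • (K + Kᴴ)) (by
    rw [conjTranspose_smul, conjTranspose_add, conjTranspose_conjTranspose, add_comm, ← neg_smul]
    simp)
  have h3 := add_mem h1 h2
  convert h3 using 1
  ext ⟨i, a⟩ ⟨j, b⟩
  have hI := Complex.I_mul_I
  fin_cases a <;> fin_cases b <;> simp [pauliX, pauliY]
  · linear_combination (-(2⁻¹ : ℂ)) * (K i j + starRingEnd ℂ (K j i)) * hI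
  · linear_combination (2⁻¹ : ℂ) * (K i j + starRingEnd ℂ (K j i)) * hI

end IsEvolutionClass

end Environment

/-! ### Kraus decomposition of channels -/

section Kraus

open Matrix

variable {n : Type*} [Fintype n] [DecidableEq n]

open scoped MatrixOrder in
theorem exists_eq_star_mul_self {A : Matrix n n ℂ} (hA : A.PosSemidef) :
    ∃ B : Matrix n n ℂ, A = star B * B :=
  CStarAlgebra.nonneg_iff_eq_star_mul_self.mp hA.nonneg

/-- Choi's argument: the amplification of `Φ` maps the projector onto the unnormalized maximally
entangled vector `v` to `B^* B`; the conjugated rows of `B`, reshaped to matrices, are the Kraus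
operators. -/
theorem IsCompletelyPositive.exists_kraus {Φ : SuperOp n} (hΦ : IsCompletelyPositive Φ) :
    ∃ K : n × Fin (Fintype.card n) → Matrix n n ℂ, ∀ ρ, Φ ρ = ∑ p, K p * ρ * (K p)ᴴ := by
  let e := Fintype.equivFin n
  let v : n × Fin (Fintype.card n) → ℂ := fun p => if p.2 = e p.1 then 1 else 0
  have hpos := hΦ _ _ (posSemidef_vecMulVec_self_star v)
  obtain ⟨B, hB⟩ := exists_eq_star_mul_self hpos
  refine ⟨fun p => of fun i a => star (B p (i, e a)), fun ρ => ?_⟩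
  have hsingle : ∀ a b i j, Φ (single a b 1) i j = ∑ p, star (B p (i, e a)) * B p (j, e b) := by
    intro a b i j
    have h := congrFun (congrFun hB (i, e a)) (j, e b)
    rw [star_eq_conjTranspose, mul_apply] at h
    simp only [amplify, conjTranspose_apply] at h
    have hv : single a b (1 : ℂ) = of fun x y => vecMulVec v (star v) (x, e a) (y, e b) := by
      ext x y
      by_cases hx : a = x <;> by_cases hy : b = y <;> simp [v, single, vecMulVec_apply, hx, hy]
    rw [← h, hv]
    rfl
  conv_lhs => rw [matrix_eq_sum_single ρ]
  ext i j
  have hs : ∀ a b, single a b (ρ a b) = ρ a b • single a b (1 : ℂ) := by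
    intro a b
    rw [smul_single, smul_eq_mul, mul_one]
  simp only [hs, map_sum, map_smul, Matrix.sum_apply, Matrix.smul_apply, hsingle, mul_apply, of_apply,
    conjTranspose_apply, star_star, Finset.mul_sum, Finset.sum_mul, smul_eq_mul]
  rw [Finset.sum_comm' (t' := Finset.univ) (s' := fun _ => Finset.univ) (by simp)]
  conv_rhs => rw [Finset.sum_comm]
  refine Finset.sum_congr rfl fun y _ => ?_
  rw [Finset.sum_comm]
  exact Finset.sum_congr rfl fun p _ => Finset.sum_congr rfl fun x _ => by ring

theorem IsTracePreserving.sum_kraus {Φ : SuperOp n} (hΦ : IsTracePreserving Φ) {m : Type*}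
    [Fintype m] {K : m → Matrix n n ℂ} (hK : ∀ ρ, Φ ρ = ∑ p, K p * ρ * (K p)ᴴ) :
    ∑ p, (K p)ᴴ * K p = 1 := by
  rw [ext_iff_trace_mul_left]
  intro ρ
  rw [mul_one, ← hΦ ρ, hK, Finset.mul_sum, trace_sum, trace_sum]
  refine Finset.sum_congr rfl fun p _ => ?_
  rw [← mul_assoc, ← trace_mul_cycle, ← trace_mul_cycle]

end Kraus

/-! ### Dissipators and Lindbladians in the reduced monoid -/

section Dissipator

open Matrix

theorem traceE_kronecker {ι : Type*} (A : Matrix ι ι ℂ) (P : Matrix (Fin 2) (Fin 2) ℂ) :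
    traceE (kronecker A P) = P.trace • A := by
  ext i j
  simp [traceE, trace, ← mul_add, mul_comm]

theorem traceE_tensor0 {ι : Type*} (ρ : Matrix ι ι ℂ) : traceE (tensor0 ρ) = ρ := by
  change traceE (kronecker ρ ket0bra0) = ρ
  rw [traceE_kronecker]
  simp [ket0bra0, trace]

variable {ι : Type*} [Fintype ι]

/-- The initialization of the environment as a bounded operator. -/
noncomputable def tensor0L : Matrix ι ι ℂ →L[ℂ] Matrix (ι × Fin 2) (ι × Fin 2) ℂ :=
  LinearMap.toContinuousLinearMap tensor0

/-- The partial trace over the environment as a bounded operator. -/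
noncomputable def traceEL : Matrix (ι × Fin 2) (ι × Fin 2) ℂ →L[ℂ] Matrix ι ι ℂ :=
  LinearMap.toContinuousLinearMap traceE

theorem traceEL_comp_tensor0L :
    (traceEL (ι := ι)).comp tensor0L = ContinuousLinearMap.id ℂ (Matrix ι ι ℂ) := by
  ext1 ρ
  exact traceE_tensor0 ρ

variable [DecidableEq ι]

/-- The coupling `K ⊗ |1⟩⟨0| - K^* ⊗ |0⟩⟨1|` of the system to the environment. -/
def coupling (K : Matrix ι ι ℂ) : Matrix (ι × Fin 2) (ι × Fin 2) ℂ :=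
  kronecker K !![0, 0; 1, 0] - kronecker Kᴴ !![0, 1; 0, 0]

/-- The commutator is `K ρ ⊗ |1⟩⟨0| + ρ K^* ⊗ |0⟩⟨1|`, whose environment factors are traceless. -/
theorem traceE_ad_coupling (K ρ : Matrix ι ι ℂ) :
    traceE (ad (coupling K) (tensor0 ρ)) = 0 := by
  change traceE (ad (coupling K) (kronecker ρ ket0bra0)) = 0
  simp only [ad_apply, coupling, kronecker, ket0bra0, sub_mul, mul_sub, ← mul_kronecker_mul]
  simp only [map_sub]
  have h := traceE_kronecker (ι := ι)
  simp only [kronecker] at h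
  simp [h, trace]

theorem traceE_ad_ad_coupling (K ρ : Matrix ι ι ℂ) :
    traceE (ad (coupling K) (ad (coupling K) (tensor0 ρ))) =
      (2 : ℝ) • (K * ρ * Kᴴ) - (Kᴴ * K * ρ + ρ * (Kᴴ * K)) := by
  change traceE (ad (coupling K) (ad (coupling K) (kronecker ρ ket0bra0))) = _
  simp only [ad_apply, coupling, kronecker, ket0bra0, sub_mul, mul_sub, ← mul_kronecker_mul]
  simp only [map_sub]
  have h := traceE_kronecker (ι := ι)
  simp only [kronecker] at h
  simp [h, trace, two_smul, mul_assoc]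
  abel

variable {S : Set (Matrix ι ι ℂ)} {C : Set (SuperOp (ι × Fin 2))}

/-- The superoperators `Φ` on the system such that `ρ ↦ Φ (tr_E ρ) ⊗ |0⟩⟨0|` lies in `C`. -/
def reduced (C : Set (SuperOp (ι × Fin 2))) : Set (SuperOp ι) :=
  compression C tensor0L traceEL

theorem IsEvolutionClass.isClosedConvexMonoid_reduced (hC : IsEvolutionClass S C) :
    IsClosedConvexMonoid (reduced C) :=
  hC.isClosedConvexMonoid.compression traceEL_comp_tensor0L hC.prep_mem

/-- The dissipator `ρ ↦ K ρ K^* - ½ {K^* K, ρ}`. -/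
noncomputable def dissipator (K : Matrix ι ι ℂ) : SuperOp ι :=
  (2⁻¹ : ℝ) • traceEL.comp ((ad (coupling K) * ad (coupling K)).comp tensor0L)

theorem dissipator_apply (K ρ : Matrix ι ι ℂ) :
    dissipator K ρ = K * ρ * Kᴴ - (2⁻¹ : ℝ) • (Kᴴ * K * ρ + ρ * (Kᴴ * K)) := by
  change (2⁻¹ : ℝ) • traceE (ad (coupling K) (ad (coupling K) (tensor0 ρ))) = _
  rw [traceE_ad_ad_coupling, smul_sub, smul_smul]
  simp

theorem IsEvolutionClass.dissipator_mem (hC : IsEvolutionClass S C) {T : Set (Matrix ι ι ℂ)}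
    (hT : IsHormanderSystem T) (hTS : T ⊆ (Submodule.span ℂ S : Set (Matrix ι ι ℂ)))
    (K : Matrix ι ι ℂ) : dissipator K ∈ generators (reduced C) := by
  refine IsClosedConvexMonoid.smul_mem_generators (by norm_num) ?_
  refine compress_sq_mem_generators hC.isClosedConvexMonoid traceEL_comp_tensor0L hC.prep_mem
    (hC.coupling_mem hT hTS K) ?_
  ext1 ρ
  exact traceE_ad_coupling K ρ

theorem IsChannel.sub_one_eq_sum_dissipator {Φ : SuperOp ι} (hΦ : IsChannel Φ) :
    ∃ K : ι × Fin (Fintype.card ι) → Matrix ι ι ℂ, Φ - 1 = ∑ p, dissipator (K p) := by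
  obtain ⟨K, hK⟩ := hΦ.1.exists_kraus
  have hsum := hΦ.2.sum_kraus hK
  refine ⟨K, ?_⟩
  ext1 ρ
  have e : (∑ p, dissipator (K p)) ρ = ∑ p, dissipator (K p) ρ := by simp
  rw [e]
  simp only [dissipator_apply]
  rw [Finset.sum_sub_distrib, ← hK, ← Finset.smul_sum, Finset.sum_add_distrib, ← Finset.sum_mul,
    ← Finset.mul_sum, hsum, one_mul, mul_one, ← two_smul ℝ ρ, smul_smul]
  simp

theorem IsEvolutionClass.lindbladian_mem (hC : IsEvolutionClass S C) {T : Set (Matrix ι ι ℂ)}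
    (hT : IsHormanderSystem T) (hTS : T ⊆ (Submodule.span ℂ S : Set (Matrix ι ι ℂ)))
    {L : SuperOp ι} (hL : IsLindbladian L) : L ∈ generators (reduced C) := by
  have hD := hC.isClosedConvexMonoid_reduced
  refine hD.mem_generators_of_exp_sub_one_mem fun s hs => ?_
  obtain ⟨K, hK⟩ := (hL s hs).sub_one_eq_sum_dissipator
  have hsum : ∑ p, dissipator (K p) ∈ generators (reduced C) :=
    Finset.sum_induction _ (· ∈ generators (reduced C)) (fun _ _ => hD.add_mem_generators)
      hD.zero_mem_generators fun p _ => hC.dissipator_mem hT hTS (K p)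
  rw [← hK] at hsum
  exact hsum

end Dissipator

end EnvAssisted

theorem theorem2p16 {ι : Type*} [Fintype ι] [DecidableEq ι] (S : Set (Matrix ι ι ℂ))
    (hS : ∃ T : Set (Matrix ι ι ℂ), EnvAssisted.IsHormanderSystem T ∧
      T ⊆ (Submodule.span ℂ S : Set (Matrix ι ι ℂ)))
    (L : EnvAssisted.SuperOp ι) (hL : EnvAssisted.IsLindbladian L) (t : ℝ) (ht : 0 ≤ t) :
    NormedSpace.exp ((t : ℂ) • L) ∈ EnvAssisted.chanA S := by
  obtain ⟨T, hT, hTS⟩ := hS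
  -- The witness discards `E`, applies `e^{tL}` and reinitializes `E`; its membership in `C` is
  -- membership of `e^{tL}` in `reduced C`.
  refine ⟨EnvAssisted.tensor0L.comp ((NormedSpace.exp ((t : ℂ) • L)).comp EnvAssisted.traceEL),
    fun C hC => ?_, fun ρ => ?_⟩
  · exact hC.lindbladian_mem hT hTS hL t ht
  · change _ = EnvAssisted.traceE (EnvAssisted.tensor0
      (NormedSpace.exp ((t : ℂ) • L) (EnvAssisted.traceE (EnvAssisted.tensor0 ρ))))
    rw [EnvAssisted.traceE_tensor0, EnvAssisted.traceE_tensor0]
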